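/- An \emph{obstacle} is a topologically open simple (non-self-intersecting) polygon in the plane, i.e. the bounded region enclosed by a simple closed polygonal curve. An \emph{obstacle representation} of a finite simple graph $G$ consists of a finite family of obstacles $C_1,\dots,C_k$ and an injective placement $p\colon V(G)\to\mathbb{R}^2$ of the vertices, with no three points collinear and no point in an obstacle, such that two distinct vertices $u,w$ are adjacent if and only if the segment $\overline{p(u)p(w)}$ is disjoint from every $C_i$. Drawing the vertices as the points $p(u)$ and the edges as straight-line segments, an obstacle is an \emph{outside obstacle} if it lies in the unbounded component of the complement of this drawing, and an \emph{inside obstacle} if it lies in the complement of that unbounded component. An \emph{outside-obstacle} (resp. \emph{inside-obstacle}) \emph{representation} is an obstacle representation with exactly one obstacle, which is an outside (resp. inside) obstacle. Let $\mathrm{obs}(G)$, $\mathrm{obs}_{\mathrm{out}}(G)$ and $\mathrm{obs}_{\mathrm{in}}(G)$ be the minimum number of obstacles in, respectively, any obstacle representation of $G$, one in which at least one obstacle is an outside obstacle, and one in which all obstacles are inside obstacles (with value $\infty$ if there is none). Let $B_{11}$ be the graph on the $11$ vertices $z_1,\dots,z_5,z'_1,\dots,z'_5,v$ obtained from the complete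 graph on $z_1,\dots,z_5,z'_1,\dots,z'_5$ by deleting the five edges $z_iz'_i$ and adding the vertex $v$, adjacent exactly to $z_1,\dots,z_5$. \textbf{Theorem.} $B_{11}$ is co-bipartite (its complement is bipartite), it has an inside-obstacle representation whose obstacle is a triangle, and it has no outside-obstacle representation. Moreover $\mathrm{obs}(B_{11})=\mathrm{obs}_{\mathrm{in}}(B_{11})=1$ and $\mathrm{obs}_{\mathrm{out}}(B_{11})=2$. Consequently, the following two conjectures are false: (i) (Alpert et al.) every finite graph $G$ with $\mathrm{obs}(G)=1$ satisfies $\mathrm{obs}_{\mathrm{out}}(G)=1$; (ii) (Berman et al.) for every $o\ge 1$, every finite graph $G$ with $\mathrm{obs}(G)=o$ satisfies $\mathrm{obs}_{\mathrm{out}}(G)=o$. -/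

import Mathlib

/-- The Euclidean plane. -/
abbrev Plane : Type := EuclideanSpace ℝ (Fin 2)

/-- The closed polygonal curve with cyclically ordered corners `q`. -/
def polygonBoundary {n : ℕ} (q : ZMod n → Plane) : Set Plane :=
  ⋃ i : ZMod n, segment ℝ (q i) (q (i + 1))

/-- The cyclically ordered corners `q` span a non-self-intersecting polygon: consecutive sides meet
exactly in their common corner, and non-consecutive sides are disjoint. -/
structure IsSimplePolygon {n : ℕ} (q : ZMod n → Plane) : Prop where
  three_le : 3 ≤ n
  injective : Function.Injective q
  consecutive : ∀ i : ZMod n,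
    segment ℝ (q i) (q (i + 1)) ∩ segment ℝ (q (i + 1)) (q (i + 2)) = {q (i + 1)}
  nonconsecutive : ∀ i j : ZMod n, i ≠ j → j ≠ i + 1 → i ≠ j + 1 →
    Disjoint (segment ℝ (q i) (q (i + 1))) (segment ℝ (q j) (q (j + 1)))

/-- The (topologically open) region enclosed by a closed polygonal curve: the points off the curve
whose component in the complement of the curve is bounded. -/
def polygonRegion {n : ℕ} (q : ZMod n → Plane) : Set Plane :=
  {x | x ∉ polygonBoundary q ∧
    Bornology.IsBounded (connectedComponentIn (polygonBoundary q)ᶜ x)}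

/-- `C` is a (topologically open) non-self-intersecting polygon with `n` corners. -/
def IsOpenPolygon (n : ℕ) (C : Set Plane) : Prop :=
  ∃ q : ZMod n → Plane, IsSimplePolygon q ∧ C = polygonRegion q

/-- The points `p v` are pairwise distinct and no three of them are collinear. -/
def InGeneralPosition {V : Type*} (p : V → Plane) : Prop :=
  Function.Injective p ∧
    ∀ u v w : V, u ≠ v → u ≠ w → v ≠ w → ¬ Collinear ℝ {p u, p v, p w}

/-- The points `p v`, in general position and outside all obstacles `C i`, represent `G`: the graph
`G` is the visibility graph of the points with respect to these obstacles. -/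
structure IsObstacleRepresentation {V ι : Type*} (G : SimpleGraph V) (p : V → Plane)
    (C : ι → Set Plane) : Prop where
  polygon : ∀ i, ∃ n : ℕ, IsOpenPolygon n (C i)
  generalPosition : InGeneralPosition p
  notMem : ∀ v i, p v ∉ C i
  adj_iff : ∀ u v, G.Adj u v ↔ u ≠ v ∧ ∀ i, segment ℝ (p u) (p v) ∩ C i = ∅

/-- The straight-line drawing of `G` with vertices placed at `p`. -/
def drawing {V : Type*} (G : SimpleGraph V) (p : V → Plane) : Set Plane :=
  Set.range p ∪ ⋃ (u : V) (v : V) (_ : G.Adj u v), segment ℝ (p u) (p v)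

/-- The unbounded component of the complement of `D`
(for bounded `D` in the plane there is exactly one). -/
def unboundedComponent (D : Set Plane) : Set Plane :=
  {x | x ∉ D ∧ ¬ Bornology.IsBounded (connectedComponentIn Dᶜ x)}

/-- `C` lies in the unbounded component of the drawing. -/
def IsOutsideObstacle {V : Type*} (G : SimpleGraph V) (p : V → Plane) (C : Set Plane) : Prop :=
  C ⊆ unboundedComponent (drawing G p)

/-- `C` lies in the complement of the unbounded component of the drawing. -/
def IsInsideObstacle {V : Type*} (G : SimpleGraph V) (p : V → Plane) (C : Set Plane) : Prop :=
  C ⊆ (unboundedComponent (drawing G p))ᶜ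

/-- `G` can be represented by a single outside obstacle. -/
def HasOutsideObstacleRepresentation {V : Type*} (G : SimpleGraph V) : Prop :=
  ∃ (p : V → Plane) (C : Set Plane),
    IsObstacleRepresentation G p (fun _ : Fin 1 => C) ∧ IsOutsideObstacle G p C

/-- `G` can be represented by a single inside obstacle that is a polygon with `n` corners. -/
def HasInsideObstacleRepresentationWith {V : Type*} (G : SimpleGraph V) (n : ℕ) : Prop :=
  ∃ (p : V → Plane) (C : Set Plane),
    IsObstacleRepresentation G p (fun _ : Fin 1 => C) ∧ IsInsideObstacle G p C ∧
      IsOpenPolygon n C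

/-- The obstacle number: the least number of obstacles in an obstacle representation of `G`
(`⊤` if there is none). -/
noncomputable def obs {V : Type*} (G : SimpleGraph V) : ℕ∞ :=
  ⨅ (k : ℕ) (_ : ∃ (p : V → Plane) (C : Fin k → Set Plane), IsObstacleRepresentation G p C),
    (k : ℕ∞)

/-- The outside-obstacle number: the least number of obstacles in an obstacle representation
of `G` in which some obstacle is an outside obstacle. -/
noncomputable def obsOut {V : Type*} (G : SimpleGraph V) : ℕ∞ :=
  ⨅ (k : ℕ) (_ : ∃ (p : V → Plane) (C : Fin k → Set Plane), IsObstacleRepresentation G p C ∧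
    ∃ i, IsOutsideObstacle G p (C i)), (k : ℕ∞)

/-- The inside-obstacle number: the least number of obstacles in an obstacle representation
of `G` in which all obstacles are inside obstacles. -/
noncomputable def obsIn {V : Type*} (G : SimpleGraph V) : ℕ∞ :=
  ⨅ (k : ℕ) (_ : ∃ (p : V → Plane) (C : Fin k → Set Plane), IsObstacleRepresentation G p C ∧
    ∀ i, IsInsideObstacle G p (C i)), (k : ℕ∞)

/-- The vertices of `B₁₁`: five vertices `z i`, five vertices `z' i`, and the vertex `v`. -/
inductive B11Vertex : Type where
  | z (i : Fin 5)
  | z' (i : Fin 5)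
  | v

/-- `z i` and `z' i` span `K₁₀` minus the perfect matching of the pairs `z i`, `z' i`;
the vertex `v` is adjacent to exactly the five vertices `z i`. -/
def B11 : SimpleGraph B11Vertex where
  Adj
    | .z i, .z j => i ≠ j
    | .z' i, .z' j => i ≠ j
    | .z i, .z' j => i ≠ j
    | .z' i, .z j => i ≠ j
    | .z _, .v => True
    | .v, .z _ => True
    | .z' _, .v => False
    | .v, .z' _ => False
    | .v, .v => False
  symm := ⟨by
    rintro (i | i | _) (j | j | _) h <;> first | exact h | exact Ne.symm h⟩
  loopless := ⟨by
    rintro (i | i | _) h <;> first | exact h | exact h rfl⟩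

/-! The negative half uses only that, with a single outside obstacle, every non-edge meets the
unbounded component of the drawing. A triangle of edges shields its hull from that component. So if
adjacent common neighbours a, b of a non-edge uw lay on opposite sides of the line uw, the triangles
uab and wab would together hide the segment uw (`orient_mul_orient_pos_of_adj`). Hence each line z_k
z'_k has the other eight of the ten points z_i, z'_i on one side, and each line v z'_k has the four
z_i with i ≠ k on one side.

The second fact makes the angular order of the z_i about v a strict linear order, with extremes z_m
and z_M. For each of the three remaining k, the line v z_m or the line v z_M crosses the segment
z'_k z_k, so by pigeonhole one line v z_n crosses two such segments. The two crossings and z_n are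
then three points of one line, each on a supporting line that has the other two strictly on one
side. None lies between the other two, which is absurd (`not_ray_crosses_supporting_segments`).

For the positive half, the z_i and z'_i are antipodal on a nearly regular decagon. A central
triangle blocks the long diagonals, and v sits just above it, so that it sees only the z_i. Signed
areas at integer points reduce every check to a finite computation. A remote second triangle that
blocks nothing gives `obsOut` at most 2. -/

/-! ### Signed areas and collinearity. -/

/-- Twice the signed area of the triangle `a b c`. -/
def orient (a b c : Plane) : ℝ :=
  (b 0 - a 0) * (c 1 - a 1) - (b 1 - a 1) * (c 0 - a 0)

lemma Plane.ext' {x y : Plane} (h0 : x 0 = y 0) (h1 : x 1 = y 1) : x = y := by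
  ext i; fin_cases i <;> assumption

lemma orient_combo (a b x y : Plane) {s t : ℝ} (h : s + t = 1) :
    orient a b (s • x + t • y) = s * orient a b x + t * orient a b y := by
  obtain rfl : s = 1 - t := by linarith
  simp only [orient, PiLp.add_apply, PiLp.smul_apply, smul_eq_mul]
  ring

lemma orient_rotate (a b c : Plane) : orient b c a = orient a b c := by
  simp only [orient]; ring

lemma orient_swap (a b c : Plane) : orient a c b = -orient a b c := by
  simp only [orient]; ring

lemma orient_swap_left (a b c : Plane) : orient b a c = -orient a b c := by
  simp only [orient]; ring

lemma orient_self_left (a b : Plane) : orient a a b = 0 := by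
  simp only [orient]; ring

lemma orient_self_right (a b : Plane) : orient a b b = 0 := by
  simp only [orient]; ring

lemma orient_self_outer (a b : Plane) : orient a b a = 0 := by
  simp only [orient]; ring

lemma orient_add_orient_add_orient (a b c x : Plane) :
    orient b c x + orient c a x + orient a b x = orient a b c := by
  simp only [orient]; ring

lemma orient_smul_eq (a b c x : Plane) :
    orient a b c • x = orient b c x • a + orient c a x • b + orient a b x • c := by
  apply Plane.ext' <;>
  · simp only [orient, PiLp.add_apply, PiLp.smul_apply, smul_eq_mul]
    ring

/-- The Plücker relation for four vectors based at v; it yields transitivity of the angular order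
about v. -/
lemma orient_plucker (v a b c d : Plane) :
    orient v a b * orient v c d - orient v a c * orient v b d + orient v a d * orient v b c = 0 := by
  simp only [orient]; ring

lemma continuous_orient (a b : Plane) : Continuous (orient a b) := by
  unfold orient; fun_prop

lemma orient_pos_of_mem_segment {a b x y z : Plane} (h : z ∈ segment ℝ x y) (r : ℝ)
    (hx : 0 < r * orient a b x) (hy : 0 < r * orient a b y) : 0 < r * orient a b z := by
  obtain ⟨s, t, hs, ht, hst, rfl⟩ := h
  rw [orient_combo a b x y hst]
  rcases hs.eq_or_lt with rfl | hs'
  · obtain rfl : t = 1 := by linarith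
    simpa using hy
  · have := mul_pos hs' hx
    have := mul_nonneg ht hy.le
    linarith

lemma orient_eq_zero_of_mem_segment {a b x : Plane} (h : x ∈ segment ℝ a b) :
    orient a b x = 0 := by
  obtain ⟨s, t, -, -, hst, rfl⟩ := h
  rw [orient_combo _ _ _ _ hst, orient_self_outer, orient_self_right]
  ring

lemma convex_orient_nonneg (a b : Plane) : Convex ℝ {x | 0 ≤ orient a b x} := by
  intro x hx y hy s t hs ht hst
  rw [Set.mem_ofPred_eq, orient_combo a b x y hst]
  exact add_nonneg (mul_nonneg hs hx) (mul_nonneg ht hy)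

lemma convex_orient_neg (a b : Plane) : Convex ℝ {x | orient a b x < 0} := by
  intro x hx y hy s t hs ht hst
  have h := orient_pos_of_mem_segment (a := a) (b := b) (z := s • x + t • y)
    ⟨s, t, hs, ht, hst, rfl⟩ (-1) (by simpa using hx) (by simpa using hy)
  simpa using h

lemma exists_eq_lineMap_of_orient_eq_zero {a b c : Plane} (hab : a ≠ b)
    (h : orient a b c = 0) : ∃ r : ℝ, c = AffineMap.lineMap a b r := by
  simp only [orient] at h
  by_cases h0 : b 0 - a 0 = 0
  · have h1 : b 1 - a 1 ≠ 0 := fun h1 => hab (Plane.ext' (by linarith) (by linarith))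
    rw [h0] at h
    have hc : c 0 - a 0 = 0 := by
      rcases mul_eq_zero.1 (show (b 1 - a 1) * (c 0 - a 0) = 0 by linarith) with h | h
      · exact absurd h h1
      · exact h
    refine ⟨(c 1 - a 1) / (b 1 - a 1), Plane.ext' ?_ ?_⟩ <;>
      simp [AffineMap.lineMap_apply, h0, h1]
    linarith
  · refine ⟨(c 0 - a 0) / (b 0 - a 0), Plane.ext' ?_ ?_⟩ <;>
      simp [AffineMap.lineMap_apply, h0]
    field_simp
    linarith

lemma collinear_iff_orient_eq_zero {a b c : Plane} :
    Collinear ℝ {a, b, c} ↔ orient a b c = 0 := by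
  constructor
  · intro h
    obtain ⟨w, hw⟩ := (collinear_iff_of_mem (p₀ := a) (by simp)).1 h
    obtain ⟨r, hr⟩ := hw b (by simp)
    obtain ⟨s, hs⟩ := hw c (by simp)
    rw [hr, hs]
    simp [orient]
    ring
  · intro h
    by_cases hab : a = b
    · subst hab
      simpa using collinear_pair ℝ a c
    obtain ⟨r, hr⟩ := exists_eq_lineMap_of_orient_eq_zero hab h
    refine (collinear_iff_of_mem (p₀ := a) (by simp)).2 ⟨b - a, ?_⟩
    rintro p (rfl | rfl | rfl)
    · exact ⟨0, by simp⟩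
    · exact ⟨1, by simp⟩
    · exact ⟨r, by rw [hr]; simp [AffineMap.lineMap_apply]⟩

/-! ### Triangles as barriers to the unbounded component. -/

/-- The open triangle with counterclockwise corners `a`, `b`, `c`. -/
def openTriangle (a b c : Plane) : Set Plane :=
  {x | 0 < orient a b x ∧ 0 < orient b c x ∧ 0 < orient c a x}

/-- The barycentric coordinates are the ratios of signed areas. -/
lemma eq_barycentric {a b c : Plane} (h : 0 < orient a b c) (x : Plane) :
    x = (orient b c x / orient a b c) • a + (orient c a x / orient a b c) • b +
      (orient a b x / orient a b c) • c := by
  have := congrArg ((orient a b c)⁻¹ • ·) (orient_smul_eq a b c x)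
  simpa [smul_smul, smul_add, h.ne', div_eq_inv_mul] using this

lemma isBounded_openTriangle {a b c : Plane} (h : 0 < orient a b c) :
    Bornology.IsBounded (openTriangle a b c) := by
  refine isBounded_iff_forall_norm_le.2 ⟨‖a‖ + ‖b‖ + ‖c‖, ?_⟩
  rintro x ⟨h1, h2, h3⟩
  have hs := orient_add_orient_add_orient a b c x
  have key : ∀ (y : Plane) (r : ℝ), 0 < r → r ≤ orient a b c →
      ‖(r / orient a b c) • y‖ ≤ ‖y‖ := fun y r hr hr' => by
    rw [norm_smul, Real.norm_of_nonneg (div_nonneg hr.le h.le)]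
    exact mul_le_of_le_one_left (norm_nonneg y) ((div_le_one h).2 hr')
  calc ‖x‖ = _ := congrArg norm (eq_barycentric h x)
    _ ≤ _ := norm_add₃_le
    _ ≤ _ := add_le_add_three (key _ _ h2 (by linarith)) (key _ _ h3 (by linarith))
      (key _ _ h1 (by linarith))

lemma mem_segment_of_orient_eq_zero {a b c x : Plane} (h : 0 < orient a b c)
    (h1 : orient a b x = 0) (h2 : 0 ≤ orient b c x) (h3 : 0 ≤ orient c a x) :
    x ∈ segment ℝ a b := by
  refine ⟨orient b c x / orient a b c, orient c a x / orient a b c, div_nonneg h2 h.le,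
    div_nonneg h3 h.le, ?_, ?_⟩
  · rw [← add_div, div_eq_one_iff_eq h.ne', ← orient_add_orient_add_orient a b c x, h1, add_zero]
  · conv_rhs => rw [eq_barycentric h x]
    simp [h1]

lemma orient_nonneg_of_mem_convexHull {a b c x : Plane} (h : 0 < orient a b c)
    (hx : x ∈ convexHull ℝ {a, b, c}) :
    0 ≤ orient a b x ∧ 0 ≤ orient b c x ∧ 0 ≤ orient c a x := by
  have h' := (orient_rotate a b c).trans_gt h
  have h'' := (orient_rotate b c a).trans_gt h'
  refine ⟨convexHull_min ?_ (convex_orient_nonneg a b) hx,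
    convexHull_min ?_ (convex_orient_nonneg b c) hx,
    convexHull_min ?_ (convex_orient_nonneg c a) hx⟩ <;>
  · rintro y (rfl | rfl | rfl) <;>
      simp [orient_self_right, orient_self_outer, h.le, h'.le, h''.le]

lemma isOpen_openTriangle (a b c : Plane) : IsOpen (openTriangle a b c) :=
  (isOpen_lt continuous_const (continuous_orient a b)).inter
    ((isOpen_lt continuous_const (continuous_orient b c)).inter
      (isOpen_lt continuous_const (continuous_orient c a)))

lemma mem_openTriangle_or_mem_segment {a b c x : Plane} (h : 0 < orient a b c)
    (h1 : 0 ≤ orient a b x) (h2 : 0 ≤ orient b c x) (h3 : 0 ≤ orient c a x) :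
    x ∈ openTriangle a b c ∨
      x ∈ segment ℝ a b ∪ segment ℝ b c ∪ segment ℝ c a := by
  rcases h1.eq_or_lt with h1' | h1'
  · exact .inr (.inl (.inl (mem_segment_of_orient_eq_zero h h1'.symm h2 h3)))
  have h' := (orient_rotate a b c).trans_gt h
  rcases h2.eq_or_lt with h2' | h2'
  · exact .inr (.inl (.inr (mem_segment_of_orient_eq_zero h' h2'.symm h3 h1)))
  have h'' := (orient_rotate b c a).trans_gt h'
  rcases h3.eq_or_lt with h3' | h3'
  · exact .inr (.inr (mem_segment_of_orient_eq_zero h'' h3'.symm h1 h2))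
  · exact .inl ⟨h1', h2', h3'⟩

/-- A connected set that avoids the sides of a triangle and meets its interior stays inside. -/
lemma IsPreconnected.subset_openTriangle {a b c : Plane} {S : Set Plane} (hS : IsPreconnected S)
    (h : 0 < orient a b c)
    (hd : Disjoint S (segment ℝ a b ∪ segment ℝ b c ∪ segment ℝ c a))
    (hn : (S ∩ openTriangle a b c).Nonempty) : S ⊆ openTriangle a b c := by
  have hlt : ∀ a b : Plane, IsOpen {x | orient a b x < 0} := fun a b =>
    isOpen_lt (continuous_orient a b) continuous_const
  refine hS.subset_left_of_subset_union (isOpen_openTriangle a b c)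
    (v := {x | orient a b x < 0} ∪ {x | orient b c x < 0} ∪ {x | orient c a x < 0})
    (((hlt a b).union (hlt b c)).union (hlt c a)) ?_ ?_ hn
  · refine Set.disjoint_left.2 ?_
    rintro x ⟨h1, h2, h3⟩ ((h | h) | h)
    · exact lt_asymm h1 h
    · exact lt_asymm h2 h
    · exact lt_asymm h3 h
  · intro x hx
    by_cases h1 : orient a b x < 0
    · exact .inr (.inl (.inl h1))
    by_cases h2 : orient b c x < 0
    · exact .inr (.inl (.inr h2))
    by_cases h3 : orient c a x < 0
    · exact .inr (.inr h3)
    · rcases mem_openTriangle_or_mem_segment h (not_lt.1 h1) (not_lt.1 h2) (not_lt.1 h3)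
        with hx' | hx'
      · exact .inl hx'
      · exact absurd hx' (Set.disjoint_left.1 hd hx)

lemma isBounded_connectedComponentIn_of_mem_openTriangle {a b c x : Plane} {D : Set Plane}
    (h : 0 < orient a b c)
    (hD : segment ℝ a b ∪ segment ℝ b c ∪ segment ℝ c a ⊆ D) (hxD : x ∉ D)
    (hx : x ∈ openTriangle a b c) : Bornology.IsBounded (connectedComponentIn Dᶜ x) := by
  refine (isBounded_openTriangle h).subset
    (isPreconnected_connectedComponentIn.subset_openTriangle h ?_ ⟨x, ?_, hx⟩)
  · exact (Set.disjoint_left.2 fun y hy hy' =>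
      connectedComponentIn_subset _ _ hy (hD hy'))
  · exact mem_connectedComponentIn hxD

lemma notMem_unboundedComponent_of_mem_convexHull {a b c x : Plane} {D : Set Plane}
    (h : orient a b c ≠ 0) (hab : segment ℝ a b ⊆ D) (hbc : segment ℝ b c ⊆ D)
    (hca : segment ℝ c a ⊆ D) (hx : x ∈ convexHull ℝ {a, b, c}) :
    x ∉ unboundedComponent D := by
  wlog h' : 0 < orient a b c generalizing a b c
  · have h'' : 0 < orient a c b := by
      rw [orient_swap]
      exact neg_pos.2 (lt_of_le_of_ne (not_lt.1 h') h)
    refine this h''.ne' ?_ ?_ ?_ ?_ h''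
    · rwa [segment_symm]
    · rwa [segment_symm]
    · rwa [segment_symm]
    · rwa [Set.pair_comm]
  rintro ⟨hxD, hub⟩
  have hD := Set.union_subset (Set.union_subset hab hbc) hca
  obtain ⟨h1, h2, h3⟩ := orient_nonneg_of_mem_convexHull h' hx
  rcases mem_openTriangle_or_mem_segment h' h1 h2 h3 with hx' | hx'
  · exact hub (isBounded_connectedComponentIn_of_mem_openTriangle h' hD hxD hx')
  · exact hxD (hD hx')

/-! ### Drawings and the sides of non-edges. -/

lemma segment_subset_drawing {V : Type*} {G : SimpleGraph V} {p : V → Plane} {u w : V}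
    (h : G.Adj u w) : segment ℝ (p u) (p w) ⊆ drawing G p := fun _ hx =>
  .inr (Set.mem_iUnion.2 ⟨u, Set.mem_iUnion.2 ⟨w, Set.mem_iUnion.2 ⟨h, hx⟩⟩⟩)

/-- A triangle all of whose sides are drawn does not meet the unbounded component. -/
lemma convexHull_disjoint_unboundedComponent {V : Type*} {G : SimpleGraph V} {p : V → Plane}
    (hp : InGeneralPosition p) {a b c : V} (hab : G.Adj a b) (hbc : G.Adj b c) (hca : G.Adj c a)
    {x : Plane} (hx : x ∈ convexHull ℝ {p a, p b, p c}) :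
    x ∉ unboundedComponent (drawing G p) := by
  have key : ∀ {u w : V}, G.Adj u w → segment ℝ (p u) (p w) ⊆ drawing G p :=
    segment_subset_drawing
  refine notMem_unboundedComponent_of_mem_convexHull ?_ (key hab) (key hbc) (key hca) hx
  exact fun h => hp.2 a b c hab.ne hca.ne' hbc.ne (collinear_iff_orient_eq_zero.2 h)

lemma exists_mem_segment_orient_eq_zero {u w a b : Plane}
    (h : orient u w a * orient u w b < 0) : ∃ y ∈ segment ℝ a b, orient u w y = 0 := by
  have hne : orient u w a - orient u w b ≠ 0 := fun h' => by
    rw [sub_eq_zero.1 h'] at h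
    exact absurd h (not_lt.2 (mul_self_nonneg _))
  set A := orient u w a
  set B := orient u w b
  have hsq : 0 < (A - B) ^ 2 := by positivity
  have hst : -B / (A - B) + A / (A - B) = 1 := by field_simp; ring
  refine ⟨(-B / (A - B)) • a + (A / (A - B)) • b, ⟨_, _, ?_, ?_, hst, rfl⟩, ?_⟩
  · have : -B / (A - B) = (B ^ 2 - A * B) / (A - B) ^ 2 := by field_simp; ring
    rw [this]
    exact div_nonneg (by nlinarith [sq_nonneg B]) hsq.le
  · have : A / (A - B) = (A ^ 2 - A * B) / (A - B) ^ 2 := by field_simp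
    rw [this]
    exact div_nonneg (by nlinarith [sq_nonneg A]) hsq.le
  · rw [orient_combo _ _ _ _ hst]
    change -B / (A - B) * A + A / (A - B) * B = 0
    field_simp
    ring

lemma segment_subset_of_mem_line {u w y : Plane} (huw : u ≠ w) (h : orient u w y = 0) :
    segment ℝ u w ⊆ segment ℝ u y ∪ segment ℝ w y := by
  obtain ⟨r, hr⟩ := exists_eq_lineMap_of_orient_eq_zero huw h
  rw [← insert_endpoints_openSegment]
  refine Set.insert_subset (.inl (left_mem_segment ℝ u y))
    (Set.insert_subset (.inr (left_mem_segment ℝ w y)) ?_)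
  refine (openSegment_subset_union u w ⟨r, hr.symm⟩).trans ?_
  refine Set.insert_subset (.inl (right_mem_segment ℝ u y)) ?_
  rw [openSegment_symm ℝ y w]
  exact Set.union_subset_union (openSegment_subset_segment ℝ u y)
    (openSegment_subset_segment ℝ w y)

lemma InGeneralPosition.orient_ne_zero {V : Type*} {p : V → Plane} (hp : InGeneralPosition p)
    {a b c : V} (hab : a ≠ b) (hac : a ≠ c) (hbc : b ≠ c) : orient (p a) (p b) (p c) ≠ 0 :=
  fun h => hp.2 a b c hab hac hbc (collinear_iff_orient_eq_zero.2 h)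

/-- If every non-edge is visible from the unbounded component, then adjacent common neighbours of
the ends of a non-edge lie on the same side of it. -/
lemma orient_mul_orient_pos_of_adj {V : Type*} {G : SimpleGraph V} {p : V → Plane}
    (hp : InGeneralPosition p)
    (H : ∀ u w, u ≠ w → ¬ G.Adj u w →
      (segment ℝ (p u) (p w) ∩ unboundedComponent (drawing G p)).Nonempty)
    {u w a b : V} (huw : u ≠ w) (hG : ¬ G.Adj u w) (hab : G.Adj a b) (hua : G.Adj u a)
    (hub : G.Adj u b) (hwa : G.Adj w a) (hwb : G.Adj w b) :
    0 < orient (p u) (p w) (p a) * orient (p u) (p w) (p b) := by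
  by_contra hneg
  have hlt := lt_of_le_of_ne (not_lt.1 hneg)
    (mul_ne_zero (hp.orient_ne_zero huw hua.ne hwa.ne) (hp.orient_ne_zero huw hub.ne hwb.ne))
  obtain ⟨y, hy, hy0⟩ := exists_mem_segment_orient_eq_zero hlt
  -- The crossing point y lies on the edge ab, so the segment from u or from w to y stays in a
  -- triangle of edges.
  have key : ∀ {u : V}, segment ℝ (p u) y ⊆ convexHull ℝ {p u, p a, p b} := fun {u} =>
    (convex_convexHull ℝ _).segment_subset (subset_convexHull ℝ _ (by simp))
      (segment_subset_convexHull (by simp) (by simp) hy)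
  obtain ⟨x, hx, hxU⟩ := H u w huw hG
  rcases segment_subset_of_mem_line (hp.1.ne huw) hy0 hx with hx | hx
  · exact convexHull_disjoint_unboundedComponent hp hua hab hub.symm (key hx) hxU
  · exact convexHull_disjoint_unboundedComponent hp hwa hab hwb.symm (key hx) hxU

/-! ### Lines through a point crossing two segments. -/

/-- The directions w and z lie on opposite sides of the line vm. The parameter t has the sign of `r
* orient v w z`, so it may be negative: what is hit is the line, not necessarily the ray. -/
lemma exists_mem_segment_eq_lineMap {v m w z : Plane} {r : ℝ} (h1 : 0 < r * orient v w m)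
    (h2 : 0 < r * orient v m z) :
    ∃ t : ℝ, AffineMap.lineMap v m t ∈ segment ℝ w z := by
  set A := r * orient v w m with hA
  set B := r * orient v m z with hB
  have hAB : A + B ≠ 0 := (add_pos h1 h2).ne'
  refine ⟨r * orient v w z / (A + B), B / (A + B), A / (A + B), by positivity, by positivity,
    by field_simp; ring, ?_⟩
  apply Plane.ext' <;>
  · simp only [AffineMap.lineMap_apply, PiLp.add_apply, PiLp.smul_apply, smul_eq_mul, vsub_eq_sub,
      vadd_eq_add, PiLp.sub_apply]
    field_simp
    rw [hA, hB]
    simp only [orient]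
    ring

lemma orient_lineMap (a b v m : Plane) (t : ℝ) :
    orient a b (AffineMap.lineMap v m t) =
      orient a b v + t * (orient a b m - orient a b v) := by
  rw [AffineMap.lineMap_apply_module, orient_combo _ _ _ _ (by ring)]
  ring

/-- Two segments that are both crossed by the ray from `v` through `m` are not both contained in
supporting lines of the set formed by their ends and `m` if this set also has a supporting line
through `m`. -/
lemma not_ray_crosses_supporting_segments {v m n w z w' z' : Plane} {t t' : ℝ}
    (ht : AffineMap.lineMap v m t ∈ segment ℝ w z)
    (ht' : AffineMap.lineMap v m t' ∈ segment ℝ w' z')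
    (h1 : 0 < orient w z m * orient w z w') (h2 : 0 < orient w z m * orient w z z')
    (h1' : 0 < orient w' z' m * orient w' z' w) (h2' : 0 < orient w' z' m * orient w' z' z)
    (hw : 0 < orient m n w * orient m n w) (hz : 0 < orient m n w * orient m n z)
    (hw' : 0 < orient m n w * orient m n w') (hz' : 0 < orient m n w * orient m n z') : False := by
  -- Along the line vm the signed area is affine in the parameter and vanishes at t, while m has
  -- parameter 1. Its values at 1 and t' thus multiply to a square times (1 - t)(t' - t).
  have key : ∀ {a b v m : Plane} {t t' : ℝ}, orient a b (AffineMap.lineMap v m t) = 0 →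
      0 < orient a b m * orient a b (AffineMap.lineMap v m t') → 0 < (1 - t) * (t' - t) := by
    intro a b v m t t' h0 h
    rw [orient_lineMap] at h0 h
    set k := orient a b m - orient a b v with hk
    have e : orient a b m * (orient a b v + t' * k) = k ^ 2 * ((1 - t) * (t' - t)) := by
      have hv : orient a b v = -(t * k) := by linarith
      have hm : orient a b m = k + orient a b v := by rw [hk]; ring
      rw [hm, hv]
      ring
    rw [e] at h
    exact pos_of_mul_pos_right h (sq_nonneg k)
  have a1 := key (orient_eq_zero_of_mem_segment ht) (orient_pos_of_mem_segment ht' _ h1 h2)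
  have a2 := key (orient_eq_zero_of_mem_segment ht') (orient_pos_of_mem_segment ht _ h1' h2')
  have b1 := orient_pos_of_mem_segment ht _ hw hz
  have b2 := orient_pos_of_mem_segment ht' _ hw' hz'
  have e : ∀ t, orient m n (AffineMap.lineMap v m t) = (1 - t) * orient m n v := fun t => by
    rw [orient_lineMap, orient_self_outer]; ring
  rw [e] at b1 b2
  have b3 : 0 < (1 - t) * (1 - t') := by
    have := mul_pos b1 b2
    have e' : orient m n w * ((1 - t) * orient m n v) * (orient m n w * ((1 - t') * orient m n v)) =
      (orient m n w * orient m n v) ^ 2 * ((1 - t) * (1 - t')) := by ring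
    rw [e'] at this
    exact pos_of_mul_pos_right this (sq_nonneg _)
  -- This product is -(1 - t)(1 - t')(t - t')², against the positivity in `b3`.
  have := mul_pos a1 a2
  nlinarith [mul_nonneg b3.le (sq_nonneg (t - t'))]

/-- A transitive tournament on a nonempty finite type has a least element. -/
lemma exists_forall_ne_of_trans {α : Type*} [Finite α] [Nonempty α] {r : α → α → Prop}
    (hirr : ∀ a, ¬ r a a) (htrans : ∀ a b c, r a b → r b c → r a c)
    (htot : ∀ a b, a ≠ b → r a b ∨ r b a) : ∃ m, ∀ a, a ≠ m → r m a := by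
  have : Std.Irrefl r := ⟨hirr⟩
  have : IsTrans α r := ⟨htrans⟩
  obtain ⟨m, -, hm⟩ := (Finite.wellFounded_of_trans_of_irrefl r).has_min Set.univ
    Set.univ_nonempty
  exact ⟨m, fun a ha => (htot a m ha).resolve_left (hm a (Set.mem_univ a))⟩

/-! ### No outside-obstacle representation. -/

lemma not_forall_segment_inter_unboundedComponent_nonempty {p : B11Vertex → Plane}
    (hp : InGeneralPosition p) :
    ¬ ∀ u w, u ≠ w → ¬ B11.Adj u w →
      (segment ℝ (p u) (p w) ∩ unboundedComponent (drawing B11 p)).Nonempty := by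
  intro H
  let z : Fin 5 → Plane := fun i => p (.z i)
  let w : Fin 5 → Plane := fun i => p (.z' i)
  let v : Plane := p .v
  have hside := @orient_mul_orient_pos_of_adj _ _ _ hp H
  -- the line through a matched pair is a supporting line
  have hzz : ∀ k i j, i ≠ k → j ≠ k → i ≠ j →
      0 < orient (w k) (z k) (z i) * orient (w k) (z k) (z j) := fun k i j hi hj hij =>
    hside (fun h => nomatch h) (fun h => h rfl) hij hi.symm hj.symm hi.symm hj.symm
  have hww : ∀ k i j, i ≠ k → j ≠ k → i ≠ j →
      0 < orient (w k) (z k) (w i) * orient (w k) (z k) (w j) := fun k i j hi hj hij =>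
    hside (fun h => nomatch h) (fun h => h rfl) hij hi.symm hj.symm hi.symm hj.symm
  have hzw' : ∀ k i j, i ≠ k → j ≠ k → i ≠ j →
      0 < orient (w k) (z k) (z i) * orient (w k) (z k) (w j) := fun k i j hi hj hij =>
    hside (fun h => nomatch h) (fun h => h rfl) hij hi.symm hj.symm hi.symm hj.symm
  have fin5 : ∀ a b c : Fin 5, ∃ k, k ≠ a ∧ k ≠ b ∧ k ≠ c := by decide
  have hzw : ∀ k i j, i ≠ k → j ≠ k →
      0 < orient (w k) (z k) (z i) * orient (w k) (z k) (w j) := fun k i j hi hj => by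
    -- A matched pair is not adjacent, so its two points are compared through a third point z_l.
    by_cases hij : i = j
    · subst hij
      obtain ⟨l, hl, hl', -⟩ := fin5 k i i
      have h1 := hzz k i l hi hl hl'.symm
      have h2 := hzw' k l i hl hi hl'
      have h3 := mul_pos h1 h2
      have e : orient (w k) (z k) (z i) * orient (w k) (z k) (z l) *
        (orient (w k) (z k) (z l) * orient (w k) (z k) (w i)) =
        (orient (w k) (z k) (z l)) ^ 2 * (orient (w k) (z k) (z i) * orient (w k) (z k) (w i)) := by
        ring
      rw [e] at h3
      exact pos_of_mul_pos_right h3 (sq_nonneg _)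
    · exact hzw' k i j hi hj hij
  -- the line through `v` and `z' k` has the other `z i` on one side
  have hv : ∀ k i j, i ≠ k → j ≠ k → 0 < orient v (w k) (z i) * orient v (w k) (z j) :=
    fun k i j hi hj => by
      by_cases hij : i = j
      · subst hij
        exact mul_self_pos.2 (hp.orient_ne_zero (fun h => nomatch h) (fun h => nomatch h)
          (fun h => nomatch h))
      · exact hside (fun h => nomatch h) (fun h => h) hij trivial trivial hi.symm hj.symm
  let r : Fin 5 → Fin 5 → Prop := fun i j => 0 < orient v (z i) (z j)
  have hirr : ∀ i, ¬ r i i := fun i h => by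
    simp [r, orient_self_right] at h
  have hanti : ∀ i j, r i j → ¬ r j i := fun i j h h' => by
    simp only [r] at h h'
    rw [orient_swap] at h'
    linarith
  have htot : ∀ i j, i ≠ j → r i j ∨ r j i := fun i j hij => by
    simp only [r]
    rw [orient_swap v (z i) (z j), neg_pos]
    exact (lt_or_gt_of_ne (hp.orient_ne_zero (a := .v) (b := .z i) (c := .z j)
      (fun h => nomatch h) (fun h => nomatch h) (fun h => hij (by injection h)))).symm
  -- With l distinct from i, j, k, the line v z'_l has all three points on one side; the Plücker
  -- relation then expresses the area for (i, k) as a positive combination of the other two.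
  have htrans : ∀ i j k, r i j → r j k → r i k := fun i j k hij hjk => by
    obtain ⟨l, hi, hj, hk⟩ := fin5 i j k
    have pl := orient_plucker v (w l) (z i) (z j) (z k)
    have h1 := hv l j i hj.symm hi.symm
    have h2 := hv l j k hj.symm hk.symm
    have h3 := hv l j j hj.symm hj.symm
    simp only [r] at *
    have e : (orient v (w l) (z j) * orient v (w l) (z j)) * orient v (z i) (z k) =
        (orient v (w l) (z j) * orient v (w l) (z i)) * orient v (z j) (z k) +
        (orient v (w l) (z j) * orient v (w l) (z k)) * orient v (z i) (z j) := by
      linear_combination (-orient v (w l) (z j)) * pl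
    have := mul_pos h1 hjk
    have := mul_pos h2 hij
    exact pos_of_mul_pos_right (by rw [e]; linarith) h3.le
  obtain ⟨m, hm⟩ := exists_forall_ne_of_trans hirr htrans htot
  obtain ⟨M, hM⟩ := exists_forall_ne_of_trans (r := fun i j => r j i) hirr
    (fun i j k h h' => htrans k j i h' h) (fun i j h => (htot i j h).symm)
  -- a ray from `v` does not cross two segments spanned by matched pairs
  have hcross : ∀ n i j, i ≠ n → j ≠ n → i ≠ j →
      (∃ t : ℝ, AffineMap.lineMap v (z n) t ∈ segment ℝ (w i) (z i)) →
      (∃ t : ℝ, AffineMap.lineMap v (z n) t ∈ segment ℝ (w j) (z j)) → False := by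
    rintro n i j hi hj hij ⟨t, ht⟩ ⟨t', ht'⟩
    have hn1 : ∀ x, orient (z n) (w n) x = -orient (w n) (z n) x := fun x => orient_swap_left _ _ _
    have hwi : ∀ k l, k ≠ n → l ≠ n → 0 < orient (w n) (z n) (w k) * orient (w n) (z n) (w l) :=
      fun k l hk hl => by
        by_cases hkl : k = l
        · subst hkl
          exact mul_self_pos.2 (right_ne_zero_of_mul (hzw n k k hk hk).ne')
        · exact hww n k l hk hl hkl
    refine not_ray_crosses_supporting_segments (n := w n) ht ht' (hzw i n j hi.symm hij.symm)
      (hzz i n j hi.symm hij.symm hj.symm) (hzw j n i hj.symm hij) (hzz j n i hj.symm hij hi.symm)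
      ?_ ?_ ?_ ?_
    all_goals simp only [hn1, neg_mul_neg]
    · exact hwi _ _ hi hi
    · rw [mul_comm]; exact hzw _ _ _ hi hi
    · exact hwi _ _ hi hj
    · rw [mul_comm]; exact hzw _ _ _ hj hi
  have hmM : m ≠ M := by
    rintro rfl
    obtain ⟨k, hk, -⟩ := fin5 m m m
    exact hanti _ _ (hm k hk) (hM k hk)
  have hk : ∀ k, k ≠ m → k ≠ M →
      (∃ t : ℝ, AffineMap.lineMap v (z m) t ∈ segment ℝ (w k) (z k)) ∨
      (∃ t : ℝ, AffineMap.lineMap v (z M) t ∈ segment ℝ (w k) (z k)) := fun k hkm hkM => by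
    have h := hv k m M hkm.symm hkM.symm
    have h1 : 0 < orient v (z m) (z k) := hm k hkm
    have h2 : 0 < orient v (z k) (z M) := hM k hkM
    -- Both extremes lie on one side of the line v z'_k. Depending on that side, z'_k and z_k are
    -- separated by the line through z_m or by the one through z_M.
    rcases pos_and_pos_or_neg_and_neg_of_mul_pos h with ⟨h, -⟩ | ⟨-, h⟩
    · exact .inl (exists_mem_segment_eq_lineMap (r := 1) (by simpa using h) (by simpa using h1))
    · refine .inr (exists_mem_segment_eq_lineMap (r := -1) (by simpa using h) ?_)
      rw [orient_swap]
      simpa using h2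
  have three : ∀ m M : Fin 5, m ≠ M → ∃ i j l : Fin 5, (i ≠ m ∧ j ≠ m ∧ l ≠ m) ∧
      (i ≠ M ∧ j ≠ M ∧ l ≠ M) ∧ i ≠ j ∧ i ≠ l ∧ j ≠ l := by decide
  obtain ⟨i, j, l, ⟨him, hjm, hlm⟩, ⟨hiM, hjM, hlM⟩, hij, hil, hjl⟩ := three m M hmM
  rcases hk i him hiM with hi | hi <;> rcases hk j hjm hjM with hj | hj
  · exact hcross m i j him hjm hij hi hj
  · rcases hk l hlm hlM with hl | hl
    · exact hcross m i l him hlm hil hi hl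
    · exact hcross M j l hjM hlM hjl hj hl
  · rcases hk l hlm hlM with hl | hl
    · exact hcross m j l hjm hlm hjl hj hl
    · exact hcross M i l hiM hlM hil hi hl
  · exact hcross M i j hiM hjM hij hi hj

theorem not_hasOutsideObstacleRepresentation_B11 : ¬ HasOutsideObstacleRepresentation B11 := by
  rintro ⟨p, C, hC, hout⟩
  refine not_forall_segment_inter_unboundedComponent_nonempty hC.generalPosition ?_
  intro u w huw hadj
  rw [hC.adj_iff] at hadj
  have : ¬ segment ℝ (p u) (p w) ∩ C = ∅ := fun h => hadj ⟨huw, fun _ => h⟩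
  exact (Set.nonempty_iff_ne_empty.2 this).mono (Set.inter_subset_inter_right _ hout)

/-! ### Visibility tests against a triangle. -/

lemma orient_mul_orient (a b c x y p : Plane) :
    orient a b c * orient x y p =
      orient b c p * orient x y a + orient c a p * orient x y b + orient a b p * orient x y c := by
  simp only [orient]; ring

lemma orient_pos_of_mem_openTriangle {a b c x y p : Plane} (h : 0 < orient a b c)
    (hp : p ∈ openTriangle a b c) (r : ℝ) (ha : 0 < r * orient x y a) (hb : 0 < r * orient x y b)
    (hc : 0 < r * orient x y c) : 0 < r * orient x y p := by
  obtain ⟨h1, h2, h3⟩ := hp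
  refine pos_of_mul_pos_right (a := orient a b c) ?_ h.le
  calc 0 < orient b c p * (r * orient x y a) + orient c a p * (r * orient x y b) +
      orient a b p * (r * orient x y c) := by positivity
    _ = r * (orient a b c * orient x y p) := by rw [orient_mul_orient]; ring
    _ = _ := by ring

lemma segment_inter_openTriangle_eq_empty_of_side {a b c x y u w : Plane}
    (hsub : openTriangle a b c ⊆ {p | 0 < orient u w p}) (hx : orient u w x ≤ 0)
    (hy : orient u w y ≤ 0) : segment ℝ x y ∩ openTriangle a b c = ∅ := by
  refine Set.eq_empty_of_forall_notMem ?_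
  rintro p ⟨hp, hp'⟩
  refine lt_irrefl (0 : ℝ) (lt_of_lt_of_le (hsub hp') ?_)
  obtain ⟨s, t, hs, ht, hst, rfl⟩ := hp
  rw [orient_combo _ _ _ _ hst]
  nlinarith [mul_nonneg hs (neg_nonneg.2 hx), mul_nonneg ht (neg_nonneg.2 hy)]

lemma segment_inter_openTriangle_eq_empty_of_line {a b c x y : Plane} (h : 0 < orient a b c)
    (r : ℝ) (ha : 0 < r * orient x y a) (hb : 0 < r * orient x y b)
    (hc : 0 < r * orient x y c) : segment ℝ x y ∩ openTriangle a b c = ∅ := by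
  refine Set.eq_empty_of_forall_notMem ?_
  rintro p ⟨hp, hp'⟩
  have := orient_pos_of_mem_openTriangle h hp' r ha hb hc
  simp [orient_eq_zero_of_mem_segment hp] at this

/-- The witness is the weighted mean of x and y; leaving the weights unnormalised allows integer
weights in the computation. -/
lemma segment_inter_openTriangle_ne_empty {a b c x y : Plane} {s t : ℝ} (hs : 0 < s) (ht : 0 < t)
    (hab : 0 < s * orient a b x + t * orient a b y) (hbc : 0 < s * orient b c x + t * orient b c y)
    (hca : 0 < s * orient c a x + t * orient c a y) : segment ℝ x y ∩ openTriangle a b c ≠ ∅ := by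
  have hst : s / (s + t) + t / (s + t) = 1 := by field_simp
  refine Set.Nonempty.ne_empty ⟨(s / (s + t)) • x + (t / (s + t)) • y,
    ⟨_, _, by positivity, by positivity, hst, rfl⟩, ?_⟩
  have key : ∀ {u w : Plane}, 0 < s * orient u w x + t * orient u w y →
      0 < orient u w ((s / (s + t)) • x + (t / (s + t)) • y) := fun {u w} h => by
    rw [orient_combo _ _ _ _ hst, div_mul_eq_mul_div, div_mul_eq_mul_div, ← add_div]
    positivity
  exact ⟨key hab, key hbc, key hca⟩

/-! ### Half-planes and triangles as simple polygons. -/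

lemma not_isBounded_orient_neg {a b x : Plane} (hab : a ≠ b) (hx : orient a b x < 0) :
    ¬ Bornology.IsBounded {y | orient a b y < 0} := by
  intro h
  obtain ⟨R, hR⟩ := isBounded_iff_forall_norm_le.1 h
  have hd : 0 < ‖b - a‖ := norm_pos_iff.2 (sub_ne_zero.2 hab.symm)
  have hR0 : 0 ≤ R := (norm_nonneg x).trans (hR x hx)
  -- Moving parallel to ab preserves the signed area; this s gives a displacement of length R + ‖x‖
  -- + 1, which leaves the ball of radius R.
  set s := (R + ‖x‖ + 1) / ‖b - a‖ with hs
  have hmem : orient a b (x + s • (b - a)) < 0 := by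
    have e : orient a b (x + s • (b - a)) = orient a b x := by
      simp only [orient, PiLp.add_apply, PiLp.smul_apply, PiLp.sub_apply, smul_eq_mul]
      ring
    rwa [e]
  have h1 := hR _ hmem
  have h2 : ‖s • (b - a)‖ = R + ‖x‖ + 1 := by
    rw [norm_smul, Real.norm_of_nonneg (by positivity), hs, div_mul_cancel₀ _ hd.ne']
  have h3 := norm_sub_le (x + s • (b - a)) x
  rw [add_sub_cancel_left, h2] at h3
  linarith

/-- The open half-plane is connected, unbounded and disjoint from D, so the component of x contains
it. -/
lemma mem_unboundedComponent_of_orient_neg {a b x : Plane} {D : Set Plane} (hab : a ≠ b)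
    (hD : D ⊆ {y | 0 ≤ orient a b y}) (hx : orient a b x < 0) : x ∈ unboundedComponent D := by
  have hsub : {y | orient a b y < 0} ⊆ Dᶜ := fun y hy hyD => not_lt.2 (show 0 ≤ orient a b y from hD hyD) hy
  refine ⟨hsub hx, fun h => not_isBounded_orient_neg hab hx (h.subset ?_)⟩
  exact (convex_orient_neg a b).isPreconnected.subset_connectedComponentIn hx hsub

lemma ne_of_orient_pos {a b c : Plane} (h : 0 < orient a b c) : a ≠ b := by
  rintro rfl
  simp [orient_self_left] at h

lemma polygonBoundary_three (q : ZMod 3 → Plane) :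
    polygonBoundary q = segment ℝ (q 0) (q 1) ∪ segment ℝ (q 1) (q 2) ∪ segment ℝ (q 2) (q 0) := by
  ext x
  simp only [polygonBoundary, Set.mem_iUnion, Set.mem_union]
  constructor
  · rintro ⟨i, hi⟩
    fin_cases i
    · exact .inl (.inl hi)
    · exact .inl (.inr hi)
    · exact .inr hi
  · rintro ((h | h) | h)
    exacts [⟨0, h⟩, ⟨1, h⟩, ⟨2, h⟩]

lemma polygonRegion_three {q : ZMod 3 → Plane} (h : 0 < orient (q 0) (q 1) (q 2)) :
    polygonRegion q = openTriangle (q 0) (q 1) (q 2) := by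
  have h' := (orient_rotate _ _ _).trans_gt h
  have h'' := (orient_rotate _ _ _).trans_gt h'
  have hB := polygonBoundary_three q
  have hD : polygonBoundary q ⊆ convexHull ℝ {q 0, q 1, q 2} := by
    rw [hB]
    refine Set.union_subset (Set.union_subset ?_ ?_) ?_ <;>
      exact segment_subset_convexHull (by simp) (by simp)
  ext x
  constructor
  · rintro ⟨hx, hb⟩
    have key : ∀ {a b : Plane}, a ≠ b → polygonBoundary q ⊆ {y | 0 ≤ orient a b y} →
        0 ≤ orient a b x := fun {a b} hab hsub => by
      by_contra hneg
      exact (mem_unboundedComponent_of_orient_neg hab hsub (not_le.1 hneg)).2 hb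
    refine (mem_openTriangle_or_mem_segment h
      (key (ne_of_orient_pos h) fun y hy => (orient_nonneg_of_mem_convexHull h (hD hy)).1)
      (key (ne_of_orient_pos h') fun y hy => (orient_nonneg_of_mem_convexHull h (hD hy)).2.1)
      (key (ne_of_orient_pos h'') fun y hy => (orient_nonneg_of_mem_convexHull h (hD hy)).2.2)
      ).resolve_right fun hx' => hx (hB ▸ hx')
  · intro hx
    have hxB : x ∉ polygonBoundary q := by
      rw [hB]
      obtain ⟨h1, h2, h3⟩ := hx
      rintro ((hs | hs) | hs)
      · exact h1.ne' (orient_eq_zero_of_mem_segment hs)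
      · exact h2.ne' (orient_eq_zero_of_mem_segment hs)
      · exact h3.ne' (orient_eq_zero_of_mem_segment hs)
    exact ⟨hxB, isBounded_connectedComponentIn_of_mem_openTriangle h hB.ge hxB hx⟩

lemma segment_inter_segment_of_orient_pos {a b c : Plane} (h : 0 < orient a b c) :
    segment ℝ a b ∩ segment ℝ b c = {b} := by
  refine Set.eq_singleton_iff_unique_mem.2
    ⟨⟨right_mem_segment ℝ a b, left_mem_segment ℝ b c⟩, ?_⟩
  rintro x ⟨h1, h2⟩
  have h1 := orient_eq_zero_of_mem_segment h1
  have h2 := orient_eq_zero_of_mem_segment h2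
  have h3 := orient_add_orient_add_orient a b c x
  rw [h1, h2, zero_add, add_zero] at h3
  rw [eq_barycentric h x, h1, h2, h3]
  simp [h.ne']

lemma isSimplePolygon_three {q : ZMod 3 → Plane} (h : 0 < orient (q 0) (q 1) (q 2)) :
    IsSimplePolygon q := by
  have h' := (orient_rotate _ _ _).trans_gt h
  have h'' := (orient_rotate _ _ _).trans_gt h'
  have h0 := ne_of_orient_pos h
  have h1 := ne_of_orient_pos h'
  have h2 := ne_of_orient_pos h''
  refine ⟨le_rfl, ?_, ?_, ?_⟩
  · intro i j hij
    fin_cases i <;> fin_cases j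
    exacts [rfl, absurd hij h0, absurd hij h2.symm, absurd hij h0.symm, rfl, absurd hij h1,
      absurd hij h2, absurd hij h1.symm, rfl]
  · intro i
    fin_cases i
    exacts [segment_inter_segment_of_orient_pos h, segment_inter_segment_of_orient_pos h',
      segment_inter_segment_of_orient_pos h'']
  · intro i j
    have : ∀ i j : ZMod 3, i ≠ j → j ≠ i + 1 → i ≠ j + 1 → False := by decide
    exact fun h h' h'' => (this i j h h' h'').elim

lemma isOpenPolygon_openTriangle {a b c : Plane} (h : 0 < orient a b c) :
    IsOpenPolygon 3 (openTriangle a b c) := by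
  let q : ZMod 3 → Plane := (![a, b, c] : Fin 3 → Plane)
  have hq : 0 < orient (q 0) (q 1) (q 2) := h
  exact ⟨q, isSimplePolygon_three hq, (polygonRegion_three hq).symm⟩

/-! ### Combinatorics of the graph. -/

/-- The vertices of `B11` as a sum type. -/
def B11Vertex.equivSum : B11Vertex ≃ Fin 5 ⊕ Fin 5 ⊕ Unit where
  toFun
    | .z i => .inl i
    | .z' i => .inr (.inl i)
    | .v => .inr (.inr ())
  invFun
    | .inl i => .z i
    | .inr (.inl i) => .z' i
    | .inr (.inr ()) => .v
  left_inv := by rintro (_ | _ | _) <;> rfl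
  right_inv := by rintro (_ | _ | _) <;> rfl

instance : DecidableEq B11Vertex := B11Vertex.equivSum.decidableEq

instance : Fintype B11Vertex := Fintype.ofEquiv _ B11Vertex.equivSum.symm

instance : DecidableRel B11.Adj
  | .z i, .z j => inferInstanceAs (Decidable (i ≠ j))
  | .z' i, .z' j => inferInstanceAs (Decidable (i ≠ j))
  | .z i, .z' j => inferInstanceAs (Decidable (i ≠ j))
  | .z' i, .z j => inferInstanceAs (Decidable (i ≠ j))
  | .z _, .v => inferInstanceAs (Decidable True)
  | .v, .z _ => inferInstanceAs (Decidable True)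
  | .z' _, .v => inferInstanceAs (Decidable False)
  | .v, .z' _ => inferInstanceAs (Decidable False)
  | .v, .v => inferInstanceAs (Decidable False)

lemma card_B11Vertex : Nat.card B11Vertex = 11 := by
  rw [Nat.card_congr B11Vertex.equivSum]
  simp

lemma isBipartite_compl_B11 : B11ᶜ.IsBipartite :=
  ⟨SimpleGraph.Coloring.mk (fun
    | .z _ => (0 : Fin 2)
    | .z' _ => 1
    | .v => 0) (by
      rintro (i | i | _) (j | j | _) ⟨h, h'⟩ <;> first
        | exact (by decide : (0 : Fin 2) ≠ 1)
        | exact (by decide : (1 : Fin 2) ≠ 0)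
        | exact absurd trivial h'
        | exact absurd (fun hij => h (congrArg _ hij)) h'
        | exact absurd rfl h)⟩

/-! ### An explicit placement with a triangular obstacle. -/

/-- The point of the plane with given integer coordinates. -/
noncomputable def latticePoint (x : ℤ × ℤ) : Plane := !₂[(x.1 : ℝ), (x.2 : ℝ)]

/-- Twice the signed area of a triangle with integer corners. -/
def intOrient (a b c : ℤ × ℤ) : ℤ :=
  (b.1 - a.1) * (c.2 - a.2) - (b.2 - a.2) * (c.1 - a.1)

lemma orient_latticePoint (a b c : ℤ × ℤ) :
    orient (latticePoint a) (latticePoint b) (latticePoint c) = (intOrient a b c : ℝ) := by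
  simp [orient, latticePoint, intOrient]

/-- The `z i` and their antipodes `z' i` form a nearly regular decagon, and `v` is close to its
centre. -/
def B11Vertex.coord : B11Vertex → ℤ × ℤ
  | .z i => ![(95, 31), (59, 81), (0, 100), (-59, 81), (-95, 31)] i
  | .z' i => ![(-95, -31), (-59, -81), (0, -100), (59, -81), (95, -31)] i
  | .v => (1, 8)

/-- The placement of the vertices of `B11`. -/
noncomputable def B11Vertex.point (u : B11Vertex) : Plane := latticePoint u.coord

/-- A triangular obstacle that represents `B11`. -/
def centralTriangle : Set Plane :=
  openTriangle (latticePoint (-20, 5)) (latticePoint (0, -20)) (latticePoint (20, 5))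

lemma centralTriangle_orient_pos :
    0 < orient (latticePoint (-20, 5)) (latticePoint (0, -20)) (latticePoint (20, 5)) := by
  rw [orient_latticePoint]
  exact_mod_cast (by decide : 0 < intOrient (-20, 5) (0, -20) (20, 5))

lemma inGeneralPosition_B11 : InGeneralPosition B11Vertex.point := by
  have hcol : ∀ a b c : B11Vertex, a ≠ b → a ≠ c → b ≠ c →
      intOrient a.coord b.coord c.coord ≠ 0 := by decide +kernel
  constructor
  · have hinj : ∀ a b : B11Vertex, a.coord = b.coord → a = b := by decide +kernel
    intro a b h
    have h0 := congrArg (fun x : Plane => x 0) h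
    have h1 := congrArg (fun x : Plane => x 1) h
    simp only [B11Vertex.point, latticePoint] at h0 h1
    exact hinj a b (Prod.ext (by simpa using h0) (by simpa using h1))
  · intro a b c hab hac hbc h
    rw [collinear_iff_orient_eq_zero, B11Vertex.point, B11Vertex.point, B11Vertex.point,
      orient_latticePoint] at h
    exact hcol a b c hab hac hbc (by exact_mod_cast h)

lemma segment_inter_centralTriangle_eq_empty {u w : B11Vertex} (h : B11.Adj u w) :
    segment ℝ u.point w.point ∩ centralTriangle = ∅ := by
  -- Two kinds of separation suffice: by the line of a side of the obstacle, or by the line of the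
  -- edge itself.
  have key : ∀ u w : B11Vertex, B11.Adj u w →
      (intOrient (-20, 5) (0, -20) u.coord ≤ 0 ∧ intOrient (-20, 5) (0, -20) w.coord ≤ 0) ∨
      (intOrient (0, -20) (20, 5) u.coord ≤ 0 ∧ intOrient (0, -20) (20, 5) w.coord ≤ 0) ∨
      (intOrient (20, 5) (-20, 5) u.coord ≤ 0 ∧ intOrient (20, 5) (-20, 5) w.coord ≤ 0) ∨
      (0 < intOrient u.coord w.coord (-20, 5) ∧ 0 < intOrient u.coord w.coord (0, -20) ∧
        0 < intOrient u.coord w.coord (20, 5)) ∨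
      (intOrient u.coord w.coord (-20, 5) < 0 ∧ intOrient u.coord w.coord (0, -20) < 0 ∧
        intOrient u.coord w.coord (20, 5) < 0) := by decide +kernel
  have hp := centralTriangle_orient_pos
  rcases key u w h with ⟨h1, h2⟩ | ⟨h1, h2⟩ | ⟨h1, h2⟩ | ⟨h1, h2, h3⟩ | ⟨h1, h2, h3⟩
  · refine segment_inter_openTriangle_eq_empty_of_side (fun x hx => hx.1) ?_ ?_ <;>
      rw [B11Vertex.point, orient_latticePoint] <;> exact_mod_cast ‹_›
  · refine segment_inter_openTriangle_eq_empty_of_side (fun x hx => hx.2.1) ?_ ?_ <;>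
      rw [B11Vertex.point, orient_latticePoint] <;> exact_mod_cast ‹_›
  · refine segment_inter_openTriangle_eq_empty_of_side (fun x hx => hx.2.2) ?_ ?_ <;>
      rw [B11Vertex.point, orient_latticePoint] <;> exact_mod_cast ‹_›
  · refine segment_inter_openTriangle_eq_empty_of_line hp 1 ?_ ?_ ?_ <;>
      rw [B11Vertex.point, B11Vertex.point, orient_latticePoint, one_mul] <;> exact_mod_cast ‹_›
  · refine segment_inter_openTriangle_eq_empty_of_line hp (-1) ?_ ?_ ?_ <;>
      rw [B11Vertex.point, B11Vertex.point, orient_latticePoint, neg_one_mul, neg_pos] <;>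
      exact_mod_cast ‹_›

lemma segment_inter_centralTriangle_ne_empty {u w : B11Vertex} (huw : u ≠ w)
    (h : ¬ B11.Adj u w) : segment ℝ u.point w.point ∩ centralTriangle ≠ ∅ := by
  -- Equal weights give the midpoint of an antipodal pair, the origin. The point v lies just outside
  -- the obstacle, so its non-edges enter it near v: at (9v + z'_i)/10.
  let c : B11Vertex → ℤ := fun
    | .v => 9
    | _ => 1
  have hc : ∀ u, 0 < c u := by decide
  have key : ∀ u w : B11Vertex, u ≠ w → ¬ B11.Adj u w →
      0 < c u * intOrient (-20, 5) (0, -20) u.coord +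
        c w * intOrient (-20, 5) (0, -20) w.coord ∧
      0 < c u * intOrient (0, -20) (20, 5) u.coord +
        c w * intOrient (0, -20) (20, 5) w.coord ∧
      0 < c u * intOrient (20, 5) (-20, 5) u.coord +
        c w * intOrient (20, 5) (-20, 5) w.coord := by decide +kernel
  obtain ⟨h1, h2, h3⟩ := key u w huw h
  refine segment_inter_openTriangle_ne_empty (s := (c u : ℝ)) (t := (c w : ℝ))
    (by exact_mod_cast hc u) (by exact_mod_cast hc w) ?_ ?_ ?_ <;>
    rw [B11Vertex.point, B11Vertex.point, orient_latticePoint, orient_latticePoint] <;>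
    exact_mod_cast ‹_›

lemma point_notMem_centralTriangle (u : B11Vertex) : u.point ∉ centralTriangle := by
  have key : ∀ u : B11Vertex, ¬ (0 < intOrient (-20, 5) (0, -20) u.coord ∧
      0 < intOrient (0, -20) (20, 5) u.coord ∧ 0 < intOrient (20, 5) (-20, 5) u.coord) := by
    decide +kernel
  rintro ⟨h1, h2, h3⟩
  rw [B11Vertex.point, orient_latticePoint] at h1 h2 h3
  exact key u ⟨by exact_mod_cast h1, by exact_mod_cast h2, by exact_mod_cast h3⟩

lemma isObstacleRepresentation_centralTriangle :
    IsObstacleRepresentation B11 B11Vertex.point (fun _ : Fin 1 => centralTriangle) where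
  polygon _ := ⟨3, isOpenPolygon_openTriangle centralTriangle_orient_pos⟩
  generalPosition := inGeneralPosition_B11
  notMem u _ := point_notMem_centralTriangle u
  adj_iff u w := by
    constructor
    · exact fun h => ⟨h.ne, fun _ => segment_inter_centralTriangle_eq_empty h⟩
    · rintro ⟨huw, h⟩
      by_contra hadj
      exact segment_inter_centralTriangle_ne_empty huw hadj (h 0)

lemma isInsideObstacle_centralTriangle :
    IsInsideObstacle B11 B11Vertex.point centralTriangle := by
  have hsub : ∀ {a b : ℤ × ℤ}, 0 < intOrient a b (-20, 5) → 0 < intOrient a b (0, -20) →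
      0 < intOrient a b (20, 5) → ∀ x ∈ centralTriangle,
      0 < orient (latticePoint a) (latticePoint b) x := fun {a b} h1 h2 h3 x hx => by
    have := orient_pos_of_mem_openTriangle (x := latticePoint a) (y := latticePoint b)
      centralTriangle_orient_pos hx 1
    simp only [one_mul, orient_latticePoint] at this
    exact this (by exact_mod_cast h1) (by exact_mod_cast h2) (by exact_mod_cast h3)
  rintro x hx ⟨hxD, hub⟩
  -- This triangle of edges surrounds the whole obstacle.
  refine hub (isBounded_connectedComponentIn_of_mem_openTriangle (a := B11Vertex.point (.z 0))
    (b := B11Vertex.point (.z 3)) (c := B11Vertex.point (.z' 1)) ?_ ?_ hxD ⟨?_, ?_, ?_⟩)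
  · simp only [B11Vertex.point, orient_latticePoint]
    exact_mod_cast (by decide :
      0 < intOrient (B11Vertex.z 0).coord (B11Vertex.z 3).coord (B11Vertex.z' 1).coord)
  · have h : B11.Adj (.z 0) (.z 3) ∧ B11.Adj (.z 3) (.z' 1) ∧ B11.Adj (.z' 1) (.z 0) := by decide
    exact Set.union_subset (Set.union_subset (segment_subset_drawing h.1)
      (segment_subset_drawing h.2.1)) (segment_subset_drawing h.2.2)
  all_goals exact hsub (by decide) (by decide) (by decide) x hx

/-! ### A second, harmless outside obstacle. -/

/-- A triangle away from the vertices of `B11`. -/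
def farTriangle : Set Plane :=
  openTriangle (latticePoint (0, 200)) (latticePoint (1, 200)) (latticePoint (0, 201))

lemma farTriangle_orient_pos :
    0 < orient (latticePoint (0, 200)) (latticePoint (1, 200)) (latticePoint (0, 201)) := by
  rw [orient_latticePoint]
  exact_mod_cast (by decide : 0 < intOrient (0, 200) (1, 200) (0, 201))

lemma segment_subset_orient_nonneg (u w : B11Vertex) : segment ℝ u.point w.point ⊆
    {x | 0 ≤ orient (latticePoint (1, 200)) (latticePoint (0, 200)) x} := by
  have key : ∀ u : B11Vertex, 0 ≤ intOrient (1, 200) (0, 200) u.coord := by decide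
  refine (convex_orient_nonneg _ _).segment_subset ?_ ?_ <;>
    rw [Set.mem_ofPred_eq, B11Vertex.point, orient_latticePoint] <;>
    exact_mod_cast key _

lemma orient_neg_of_mem_farTriangle {x : Plane} (hx : x ∈ farTriangle) :
    orient (latticePoint (1, 200)) (latticePoint (0, 200)) x < 0 := by
  rw [orient_swap_left, neg_lt_zero]
  exact hx.1

lemma isOutsideObstacle_farTriangle : IsOutsideObstacle B11 B11Vertex.point farTriangle := by
  intro x hx
  refine mem_unboundedComponent_of_orient_neg (ne_of_orient_pos farTriangle_orient_pos).symm ?_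
    (orient_neg_of_mem_farTriangle hx)
  refine Set.union_subset ?_ (Set.iUnion_subset fun u => Set.iUnion_subset fun w =>
    Set.iUnion_subset fun _ => segment_subset_orient_nonneg u w)
  rintro _ ⟨u, rfl⟩
  exact segment_subset_orient_nonneg u u (left_mem_segment ℝ _ _)

lemma isObstacleRepresentation_farTriangle :
    IsObstacleRepresentation B11 B11Vertex.point ![centralTriangle, farTriangle] := by
  have hR := isObstacleRepresentation_centralTriangle
  have hfar : ∀ u w : B11Vertex, segment ℝ u.point w.point ∩ farTriangle = ∅ := fun u w =>
    Set.eq_empty_of_forall_notMem fun x hx =>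
      not_le.2 (orient_neg_of_mem_farTriangle hx.2) (segment_subset_orient_nonneg u w hx.1)
  refine ⟨?_, hR.generalPosition, ?_, ?_⟩
  · exact Fin.forall_fin_two.2
      ⟨hR.polygon 0, 3, isOpenPolygon_openTriangle farTriangle_orient_pos⟩
  · exact fun u => Fin.forall_fin_two.2 ⟨hR.notMem u 0, fun h =>
      Set.notMem_empty _ ((hfar u u).subset ⟨left_mem_segment ℝ _ _, h⟩)⟩
  · intro u w
    rw [hR.adj_iff, Fin.forall_fin_two, Fin.forall_fin_one]
    simp [hfar]

/-! ### The three obstacle numbers. -/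

lemma IsObstacleRepresentation.one_le {k : ℕ} {p : B11Vertex → Plane} {C : Fin k → Set Plane}
    (h : IsObstacleRepresentation B11 p C) : 1 ≤ k := by
  rcases k with _ | k
  -- Without obstacles all pairs would be adjacent, but v and z'_0 are not.
  · exact ((h.adj_iff .v (.z' 0)).2 ⟨(fun h => nomatch h), fun i => i.elim0⟩ : False).elim
  · omega

lemma obs_B11 : obs B11 = 1 := by
  refine le_antisymm ?_ ?_
  · exact iInf₂_le_of_le 1 ⟨_, _, isObstacleRepresentation_centralTriangle⟩ le_rfl
  · refine le_iInf₂ ?_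
    rintro k ⟨p, C, h⟩
    exact_mod_cast h.one_le

lemma obsIn_B11 : obsIn B11 = 1 := by
  refine le_antisymm ?_ ?_
  · exact iInf₂_le_of_le 1 ⟨_, _, isObstacleRepresentation_centralTriangle,
      fun _ => isInsideObstacle_centralTriangle⟩ le_rfl
  · refine le_iInf₂ ?_
    rintro k ⟨p, C, h, -⟩
    exact_mod_cast h.one_le

lemma obsOut_B11 : obsOut B11 = 2 := by
  refine le_antisymm ?_ ?_
  · exact iInf₂_le_of_le 2 ⟨_, _, isObstacleRepresentation_farTriangle,
      1, isOutsideObstacle_farTriangle⟩ le_rfl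
  · refine le_iInf₂ ?_
    rintro k ⟨p, C, h, i, hi⟩
    have hk : k ≠ 1 := by
      rintro rfl
      refine not_hasOutsideObstacleRepresentation_B11 ⟨p, C i, ?_, hi⟩
      rwa [show (fun _ => C i) = C from funext fun j => congrArg C (Subsingleton.elim _ _)]
    have := h.one_le
    exact_mod_cast (by omega : 2 ≤ k)

theorem mainTheorem4 :
    Nat.card B11Vertex = 11 ∧
    B11ᶜ.IsBipartite ∧
    HasInsideObstacleRepresentationWith B11 3 ∧
    ¬ HasOutsideObstacleRepresentation B11 ∧
    obs B11 = 1 ∧ obsIn B11 = 1 ∧ obsOut B11 = 2 ∧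
    (¬ ∀ (V : Type) [Finite V] (G : SimpleGraph V), obs G = 1 → obsOut G = 1) ∧
    (¬ ∀ (o : ℕ) (V : Type) [Finite V] (G : SimpleGraph V),
      1 ≤ o → obs G = (o : ℕ∞) → obsOut G = (o : ℕ∞)) := by
  have hne : obsOut B11 ≠ 1 := by
    rw [obsOut_B11]
    decide
  exact ⟨card_B11Vertex, isBipartite_compl_B11,
    ⟨_, _, isObstacleRepresentation_centralTriangle, isInsideObstacle_centralTriangle,
      isOpenPolygon_openTriangle centralTriangle_orient_pos⟩,
    not_hasOutsideObstacleRepresentation_B11, obs_B11, obsIn_B11, obsOut_B11,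
    fun h => hne (h B11Vertex B11 obs_B11),
    fun h => hne (by exact_mod_cast h 1 B11Vertex B11 le_rfl (by exact_mod_cast obs_B11))⟩
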